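/- Let $d\ge 1$ and let $G(t,x)=(2\pi t)^{-d/2}e^{-|x|^2/(2t)}$, $t>0$, $x\in\mathbb{R}^d$. Let $f:\mathbb{R}\to\mathbb{R}$ be a continuous function such that (i) there is $\kappa\in\mathbb{R}$ with $f(u_2)-f(u_1)\le\kappa(u_2-u_1)$ for all real $u_1<u_2$; (ii) there are $K>0$ and $\nu\ge 0$ with $|f(u)|\le K e^{K|u|^{\nu}}$ for all $u\in\mathbb{R}$. Let $T>0$ and let $C_b([0,T]\times\mathbb{R}^d)$ denote the space of bounded continuous functions $[0,T]\times\mathbb{R}^d\to\mathbb{R}$. Theorem (Existence of $\mathcal{M}(z)$). For every $z\in C_b([0,T]\times\mathbb{R}^d)$ there exists $u\in C_b([0,T]\times\mathbb{R}^d)$ such that for all $(t,x)\in[0,T]\times\mathbb{R}^d$ $$u(t,x)=\int_0^t\int_{\mathbb{R}^d}G(t-s,x-y)\,f(u(s,y))\,dy\,ds+z(t,x),$$ where the integral converges absolutely. -/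

import Mathlib

open MeasureTheory
open scoped BoundedContinuousFunction

/-- The fundamental solution of the heat equation `∂ₜ G = (1/2) Δ G` in `ℝ^d`:
`G(t,x) = (2 π t)^(-d/2) exp (-|x|² / (2 t))`. Only its values at `t > 0` matter below. -/
noncomputable def heatKernel (d : ℕ) (t : ℝ) (x : EuclideanSpace ℝ (Fin d)) : ℝ :=
  (2 * Real.pi * t) ^ (-(d : ℝ) / 2) * Real.exp (-‖x‖ ^ 2 / (2 * t))

/-- The space `C_b([0,T] × ℝ^d)` of bounded continuous real functions. -/
abbrev SpaceTimeCb (d : ℕ) (T : ℝ) : Type :=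
  (Set.Icc (0 : ℝ) T × EuclideanSpace ℝ (Fin d)) →ᵇ ℝ

/-- The integrand `(s, y) ↦ G(t - s, x - y) f(u(s, y))`. It is only used for `s ∈ [0, t] ⊆ [0, T]`,
where the projection of `s` to `[0, T]` is `s` itself. -/
noncomputable def duhamelIntegrand {d : ℕ} {T : ℝ} (hT : 0 < T) (f : ℝ → ℝ)
    (u : SpaceTimeCb d T) (t : ℝ) (x : EuclideanSpace ℝ (Fin d))
    (s : ℝ) (y : EuclideanSpace ℝ (Fin d)) : ℝ :=
  heatKernel d (t - s) (x - y) * f (u (Set.projIcc 0 T hT.le s, y))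

/-- `u ∈ C_b([0,T] × ℝ^d)` solves the integral equation
`u(t,x) = ∫_0^t ∫_{ℝ^d} G(t-s,x-y) f(u(s,y)) dy ds + z(t,x)` at every `(t,x) ∈ [0,T] × ℝ^d`,
the integral on the right being absolutely convergent. -/
def SolvesIntegralEquation {d : ℕ} {T : ℝ} (hT : 0 < T) (f : ℝ → ℝ)
    (z u : SpaceTimeCb d T) : Prop :=
  ∀ (t : Set.Icc (0 : ℝ) T) (x : EuclideanSpace ℝ (Fin d)),
    IntegrableOn (fun p : ℝ × EuclideanSpace ℝ (Fin d) => duhamelIntegrand hT f u t x p.1 p.2)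
      (Set.Ioo (0 : ℝ) t ×ˢ Set.univ) ∧
    u (t, x) = (∫ s in (0 : ℝ)..t, ∫ y, duhamelIntegrand hT f u t x s y) + z (t, x)

/-! ### Gaussian form of the heat kernel -/

open ProbabilityTheory

/-! Write P_r for averaging against N(0, r I) and D h(t) = ∫_0^t P_{t-s} h(s) ds, so that the
equation reads u = D(f ∘ u) + z. With averages over one fixed Gaussian, continuity holds up to r = 0
and the kernel singularity never enters.

For Lipschitz f, Picard iteration in an exponentially weighted norm suffices. The general case rests
on the maximum principle `abs_duhamel_le`, proved without differentiating w = D h. By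
`duhamel_eq_damped`, w(t) = ∫_0^t e^{-c(t-s)} P_{t-s}(h + c w)(s) ds for every c. For c large, the
term c w dominates h wherever h pulls w towards zero, so only the one-sided bound on h counts.

This gives two estimates depending on f only through κ: stability under uniform perturbation of f
(`dist_mild_le`), and a bound on u - z in terms of sup |f ∘ z| (`abs_mild_sub_le`). The second
allows f to be modified outside [-R, R]. Since κx - f(x) is monotone, clamping its argument and
taking moving averages gives Lipschitz approximations with the same κ; by the first estimate their
solutions form a Cauchy sequence, whose limit solves the equation. -/

theorem heatKernel_nonneg {d : ℕ} {t : ℝ} (ht : 0 ≤ t) (x : EuclideanSpace ℝ (Fin d)) :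
    0 ≤ heatKernel d t x := by
  unfold heatKernel
  positivity

theorem integral_heatKernel_one (d : ℕ) :
    ∫ y : EuclideanSpace ℝ (Fin d), heatKernel d 1 y = 1 := by
  have h := GaussianFourier.integral_rexp_neg_mul_sq_norm (V := EuclideanSpace ℝ (Fin d))
    (b := 1 / 2) (by norm_num)
  have h2 : ∀ y : EuclideanSpace ℝ (Fin d), heatKernel d 1 y
      = (2 * Real.pi) ^ (-(d : ℝ) / 2) * Real.exp (-(1 / 2) * ‖y‖ ^ 2) := by
    intro y
    unfold heatKernel
    congr 2
    · ring
    · ring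
  simp_rw [h2]
  rw [integral_const_mul, h, finrank_euclideanSpace_fin,
    show Real.pi / (1 / 2) = 2 * Real.pi by ring, ← Real.rpow_add (by positivity)]
  ring_nf
  simp

theorem integrable_heatKernel_one (d : ℕ) :
    Integrable (fun y : EuclideanSpace ℝ (Fin d) => heatKernel d 1 y) :=
  -- A Bochner integral of a non-integrable function is 0, so the value 1 forces integrability.
  Integrable.of_integral_ne_zero (by rw [integral_heatKernel_one]; exact one_ne_zero)

theorem measurable_heatKernel_one (d : ℕ) :
    Measurable (fun y : EuclideanSpace ℝ (Fin d) => heatKernel d 1 y) := by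
  unfold heatKernel
  fun_prop

/-- The standard Gaussian measure has density `heatKernel d 1`. -/
theorem stdGaussian_eq_withDensity_heatKernel (d : ℕ) :
    stdGaussian (EuclideanSpace ℝ (Fin d)) =
      (volume : Measure (EuclideanSpace ℝ (Fin d))).withDensity
        fun y => ENNReal.ofReal (heatKernel d 1 y) := by
  have hfin : IsFiniteMeasure ((volume : Measure (EuclideanSpace ℝ (Fin d))).withDensity
      fun y => ENNReal.ofReal (heatKernel d 1 y)) :=
    isFiniteMeasure_withDensity_ofReal (integrable_heatKernel_one d).2
  refine Measure.ext_of_charFun (funext fun ξ => ?_)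
  rw [charFun_stdGaussian, charFun_apply, integral_withDensity_eq_integral_toReal_smul
    (measurable_heatKernel_one d).ennreal_ofReal (by simp)]
  have h := GaussianFourier.integral_cexp_neg_mul_sq_norm_add (V := EuclideanSpace ℝ (Fin d))
    (b := 1 / 2) (by norm_num) Complex.I ξ
  have h2 : ∀ y : EuclideanSpace ℝ (Fin d),
      (ENNReal.ofReal (heatKernel d 1 y)).toReal • Complex.exp (inner ℝ y ξ * Complex.I)
      = ((2 * Real.pi) ^ (-(d : ℝ) / 2) : ℝ) *
        Complex.exp (-(1 / 2) * ‖y‖ ^ 2 + Complex.I * inner ℝ ξ y) := by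
    intro y
    rw [ENNReal.toReal_ofReal (heatKernel_nonneg zero_le_one y)]
    unfold heatKernel
    rw [Complex.real_smul, Complex.exp_add, real_inner_comm, mul_one]
    push_cast
    rw [mul_assoc]
    congr 2
    · congr 1
      ring
    · congr 1
      ring
  simp_rw [h2]
  rw [integral_const_mul, h, finrank_euclideanSpace_fin, ← mul_assoc]
  have h3 : (((2 * Real.pi) ^ (-(d : ℝ) / 2) : ℝ) : ℂ) * (Real.pi / (1 / 2) : ℂ) ^ ((d : ℂ) / 2)
      = 1 := by
    rw [show (Real.pi / (1 / 2) : ℂ) = ((2 * Real.pi : ℝ) : ℂ) by push_cast; ring,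
      show ((d : ℂ) / 2) = (((d : ℝ) / 2 : ℝ) : ℂ) by push_cast; ring,
      ← Complex.ofReal_cpow (by positivity), ← Complex.ofReal_mul,
      ← Real.rpow_add (by positivity)]
    ring_nf
    simp
  rw [h3, one_mul]
  congr 1
  rw [Complex.I_sq]
  ring

theorem integral_stdGaussian_eq (d : ℕ) (g : EuclideanSpace ℝ (Fin d) → ℝ) :
    ∫ y, g y ∂(stdGaussian (EuclideanSpace ℝ (Fin d))) = ∫ y, heatKernel d 1 y * g y := by
  rw [stdGaussian_eq_withDensity_heatKernel, integral_withDensity_eq_integral_toReal_smul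
    (measurable_heatKernel_one d).ennreal_ofReal (by simp)]
  simp_rw [ENNReal.toReal_ofReal (heatKernel_nonneg zero_le_one _), smul_eq_mul]

/-- Parabolic scaling, with √r ^ d the Jacobian of y ↦ √r • y; it reduces every time r > 0 to time
1. -/
theorem heatKernel_sqrt_smul {d : ℕ} {r : ℝ} (hr : 0 < r) (y : EuclideanSpace ℝ (Fin d)) :
    heatKernel d 1 y = √r ^ d * heatKernel d r (√r • y) := by
  unfold heatKernel
  rw [norm_smul, mul_pow, Real.norm_eq_abs, sq_abs, Real.sq_sqrt hr.le,
    Real.mul_rpow (x := 2 * Real.pi) (y := r) (by positivity) hr.le, Real.sqrt_eq_rpow,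
    ← Real.rpow_natCast (r ^ (1 / 2 : ℝ)), ← Real.rpow_mul hr.le, ← mul_assoc]
  have : r ^ (1 / 2 * (d : ℝ)) * ((2 * Real.pi) ^ (-(d : ℝ) / 2) * r ^ (-(d : ℝ) / 2))
      = (2 * Real.pi * 1) ^ (-(d : ℝ) / 2) := by
    rw [mul_left_comm, ← Real.rpow_add hr]
    ring_nf
    simp
  rw [this]
  congr 2
  field_simp

/-- Averages over `N(x, r)` are convolutions with the heat kernel at time `r`. -/
theorem integral_heatKernel_mul {d : ℕ} {r : ℝ} (hr : 0 < r) (x : EuclideanSpace ℝ (Fin d))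
    (g : EuclideanSpace ℝ (Fin d) → ℝ) :
    ∫ y, heatKernel d r (x - y) * g y =
      ∫ y, g (x + √r • y) ∂(stdGaussian (EuclideanSpace ℝ (Fin d))) := by
  have hneg : ∀ y : EuclideanSpace ℝ (Fin d), heatKernel d r (-y) = heatKernel d r y := by
    intro y; simp [heatKernel]
  rw [integral_stdGaussian_eq]
  simp_rw [heatKernel_sqrt_smul hr, mul_assoc]
  rw [integral_const_mul, Measure.integral_comp_smul volume
    (fun y => heatKernel d r y * g (x + y)) √r, finrank_euclideanSpace_fin, smul_eq_mul,
    ← mul_assoc, abs_of_nonneg (by positivity), mul_inv_cancel₀ (by positivity), one_mul,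
    ← integral_add_left_eq_self _ x]
  congr 1
  ext y
  rw [sub_add_cancel_left, hneg]

/-- The semigroup property of the heat flow, in Gaussian form. -/
theorem integral_integral_stdGaussian {d : ℕ} {a b : ℝ} (ha : 0 ≤ a) (hb : 0 ≤ b)
    (g : EuclideanSpace ℝ (Fin d) →ᵇ ℝ) :
    ∫ y, ∫ y', g (√a • y + √b • y') ∂(stdGaussian (EuclideanSpace ℝ (Fin d)))
        ∂(stdGaussian (EuclideanSpace ℝ (Fin d))) =
      ∫ y, g (√(a + b) • y) ∂(stdGaussian (EuclideanSpace ℝ (Fin d))) := by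
  set γ := stdGaussian (EuclideanSpace ℝ (Fin d)) with hγ
  have hp : ∀ c : ℝ, IsProbabilityMeasure (γ.map (√c • ·)) := fun c =>
    Measure.isProbabilityMeasure_map (by fun_prop)
  -- Variances of independent Gaussians add; on characteristic functions this is the addition of
  -- exponents.
  have hconv : γ.map (√a • ·) ∗ γ.map (√b • ·) = γ.map (√(a + b) • ·) := by
    refine Measure.ext_of_charFun (funext fun ξ => ?_)
    rw [charFun_conv, charFun_map_smul, charFun_map_smul, charFun_map_smul, hγ,
      charFun_stdGaussian, charFun_stdGaussian, charFun_stdGaussian, ← Complex.exp_add]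
    congr 1
    simp only [norm_smul, Real.norm_eq_abs, mul_pow, ← Complex.ofReal_pow, Complex.ofReal_mul]
    simp only [sq_abs, Real.sq_sqrt ha, Real.sq_sqrt hb, Real.sq_sqrt (add_nonneg ha hb)]
    push_cast
    ring
  have hg : ∀ m : Measure (EuclideanSpace ℝ (Fin d)), AEStronglyMeasurable g m := fun m =>
    g.continuous.aestronglyMeasurable
  have h1 : ∫ y, g (√(a + b) • y) ∂γ = ∫ y, g y ∂(γ.map (√(a + b) • ·)) := by
    rw [integral_map (by fun_prop) (hg _)]
  rw [h1, ← hconv, integral_conv (g.integrable _), integral_map (by fun_prop)]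
  · congr 1
    ext y
    rw [integral_map (by fun_prop)]
    exact (g.continuous.comp (by fun_prop)).aestronglyMeasurable
  · refine (StronglyMeasurable.integral_prod_right'
      (f := fun p : EuclideanSpace ℝ (Fin d) × EuclideanSpace ℝ (Fin d) => g (p.1 + p.2))
      ?_).aestronglyMeasurable
    exact (g.continuous.comp (by fun_prop)).stronglyMeasurable

/-! ### Heat flow, Duhamel operator and maximum principle -/

/-- The heat flow at time `r` applied to the time slice `h(s, ·)`. -/
noncomputable def heatFlow {d : ℕ} {T : ℝ} (hT : 0 < T) (h : SpaceTimeCb d T) (s r : ℝ)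
    (x : EuclideanSpace ℝ (Fin d)) : ℝ :=
  ∫ y, h (Set.projIcc 0 T hT.le s, x + √r • y) ∂(stdGaussian (EuclideanSpace ℝ (Fin d)))

section HeatFlow

variable {d : ℕ} {T : ℝ} (hT : 0 < T)

theorem continuous_heatFlow (h : SpaceTimeCb d T) :
    Continuous fun p : ℝ × ℝ × EuclideanSpace ℝ (Fin d) => heatFlow hT h p.1 p.2.1 p.2.2 := by
  unfold heatFlow
  refine continuous_of_dominated (bound := fun _ => ‖h‖) (fun p => ?_) (fun p => ?_)
    (integrable_const _) ?_
  · exact (h.continuous.comp (by fun_prop)).aestronglyMeasurable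
  · exact ae_of_all _ fun y => h.norm_coe_le_norm _
  · refine ae_of_all _ fun y => h.continuous.comp ?_
    have := continuous_projIcc (h := hT.le)
    fun_prop

theorem Continuous.heatFlow {X : Type*} [TopologicalSpace X] (h : SpaceTimeCb d T)
    {s r : X → ℝ} {x : X → EuclideanSpace ℝ (Fin d)} (hs : Continuous s) (hr : Continuous r)
    (hx : Continuous x) : Continuous fun p => heatFlow hT h (s p) (r p) (x p) :=
  (continuous_heatFlow hT h).comp (hs.prodMk (hr.prodMk hx))

theorem integrable_heatFlow (h : SpaceTimeCb d T) (s r : ℝ) (x : EuclideanSpace ℝ (Fin d)) :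
    Integrable (fun y => h (Set.projIcc 0 T hT.le s, x + √r • y))
      (stdGaussian (EuclideanSpace ℝ (Fin d))) :=
  Integrable.of_bound (h.continuous.comp (by fun_prop)).aestronglyMeasurable ‖h‖
    (ae_of_all _ fun _ => h.norm_coe_le_norm _)

theorem abs_heatFlow_le (h : SpaceTimeCb d T) {s C : ℝ}
    (hC : ∀ y, |h (Set.projIcc 0 T hT.le s, y)| ≤ C) (r : ℝ) (x : EuclideanSpace ℝ (Fin d)) :
    |heatFlow hT h s r x| ≤ C := by
  have := norm_integral_le_of_norm_le_const (μ := stdGaussian (EuclideanSpace ℝ (Fin d)))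
    (f := fun y => h (Set.projIcc 0 T hT.le s, x + √r • y)) (C := C)
    (ae_of_all _ fun y => hC _)
  simpa [heatFlow] using this

theorem heatFlow_add_smul (h g : SpaceTimeCb d T) (c s r : ℝ) (x : EuclideanSpace ℝ (Fin d)) :
    heatFlow hT (h + c • g) s r x = heatFlow hT h s r x + c * heatFlow hT g s r x := by
  unfold heatFlow
  rw [← integral_const_mul, ← integral_add (integrable_heatFlow hT h s r x)
    ((integrable_heatFlow hT g s r x).const_mul c)]
  rfl

theorem intervalIntegrable_heatFlow (h : SpaceTimeCb d T) (t a b : ℝ)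
    (x : EuclideanSpace ℝ (Fin d)) :
    IntervalIntegrable (fun s => heatFlow hT h s (t - s) x) volume a b :=
  (Continuous.heatFlow hT h continuous_id (by fun_prop) continuous_const).intervalIntegrable _ _

/-- The Duhamel operator: the mild solution of `∂ₜ w = (1/2) Δ w + h`, `w(0) = 0`. -/
noncomputable def duhamel (h : SpaceTimeCb d T) : SpaceTimeCb d T :=
  BoundedContinuousFunction.ofNormedAddCommGroup
    (fun p => ∫ s in (0 : ℝ)..p.1, heatFlow hT h s (p.1 - s) p.2)
    (intervalIntegral.continuous_parametric_intervalIntegral_of_continuous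
      (Continuous.heatFlow hT h continuous_snd (by fun_prop) (by fun_prop)) (by fun_prop))
    (‖h‖ * T) (by
      rintro ⟨⟨t, h0, h1⟩, x⟩
      refine (intervalIntegral.norm_integral_le_of_norm_le_const (C := ‖h‖) fun s _ =>
        abs_heatFlow_le hT h (fun y => h.norm_coe_le_norm _) _ _).trans ?_
      rw [sub_zero, abs_of_nonneg h0]
      gcongr)

theorem duhamel_apply (h : SpaceTimeCb d T) (p : Set.Icc (0 : ℝ) T × EuclideanSpace ℝ (Fin d)) :
    duhamel hT h p = ∫ s in (0 : ℝ)..p.1, heatFlow hT h s (p.1 - s) p.2 := rfl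

theorem duhamel_add_smul (h g : SpaceTimeCb d T) (c : ℝ) :
    duhamel hT (h + c • g) = duhamel hT h + c • duhamel hT g := by
  ext p
  simp only [BoundedContinuousFunction.add_apply, BoundedContinuousFunction.smul_apply,
    duhamel_apply, heatFlow_add_smul, smul_eq_mul]
  rw [intervalIntegral.integral_add (intervalIntegrable_heatFlow hT h _ _ _ _)
    ((intervalIntegrable_heatFlow hT g _ _ _ _).const_mul c), intervalIntegral.integral_const_mul]

theorem duhamel_sub (h g : SpaceTimeCb d T) :
    duhamel hT (h - g) = duhamel hT h - duhamel hT g := by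
  have e : ∀ a b : SpaceTimeCb d T, a + (-1 : ℝ) • b = a - b := fun a b => by
    ext
    simp [sub_eq_add_neg]
  rw [← e, ← e, duhamel_add_smul]

theorem norm_duhamel_le (h : SpaceTimeCb d T) : ‖duhamel hT h‖ ≤ ‖h‖ * T :=
  BoundedContinuousFunction.norm_ofNormedAddCommGroup_le _ (by positivity) _

/-- Fubini moves P_a inside the time integral, and the semigroup law gives P_a P_{s-r} = P_{a+s-r}.
-/
theorem heatFlow_duhamel (h : SpaceTimeCb d T) {s a : ℝ} (hs : s ∈ Set.Icc 0 T) (ha : 0 ≤ a)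
    (x : EuclideanSpace ℝ (Fin d)) :
    heatFlow hT (duhamel hT h) s a x = ∫ r in (0 : ℝ)..s, heatFlow hT h r (a + (s - r)) x := by
  have hswap : heatFlow hT (duhamel hT h) s a x = ∫ r in (0 : ℝ)..s,
      ∫ y, heatFlow hT h r (s - r) (x + √a • y) ∂(stdGaussian (EuclideanSpace ℝ (Fin d))) := by
    have hc : Continuous fun q : EuclideanSpace ℝ (Fin d) × ℝ =>
        heatFlow hT h q.2 (s - q.2) (x + √a • q.1) :=
      Continuous.heatFlow hT h (by fun_prop) (by fun_prop) (by fun_prop)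
    have hi : Integrable (Function.uncurry fun (y : EuclideanSpace ℝ (Fin d)) (r : ℝ) =>
        heatFlow hT h r (s - r) (x + √a • y))
        ((stdGaussian (EuclideanSpace ℝ (Fin d))).prod (volume.restrict (Set.Ioc 0 s))) :=
      Integrable.of_bound hc.aestronglyMeasurable ‖h‖ (ae_of_all _ fun q =>
        abs_heatFlow_le hT h (fun y => h.norm_coe_le_norm _) (s - q.2) (x + √a • q.1))
    rw [intervalIntegral.integral_of_le hs.1, ← integral_integral_swap hi]
    conv_lhs => unfold heatFlow
    simp_rw [duhamel_apply, Set.projIcc_of_mem hT.le hs, intervalIntegral.integral_of_le hs.1]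
  rw [hswap]
  refine intervalIntegral.integral_congr fun r hr => ?_
  rw [Set.uIcc_of_le hs.1] at hr
  have := integral_integral_stdGaussian ha (sub_nonneg.2 hr.2)
    (h.compContinuous ⟨fun y => (Set.projIcc 0 T hT.le r, x + y), by fun_prop⟩)
  simpa [heatFlow, add_assoc] using this

/-- Moving a damping term `c • w` across the equation. -/
theorem duhamel_eq_damped (h : SpaceTimeCb d T) (c : ℝ)
    (p : Set.Icc (0 : ℝ) T × EuclideanSpace ℝ (Fin d)) :
    duhamel hT h p = ∫ s in (0 : ℝ)..p.1,
      Real.exp (-c * (p.1 - s)) * heatFlow hT (h + c • duhamel hT h) s (p.1 - s) p.2 := by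
  obtain ⟨⟨t, ht⟩, x⟩ := p
  rw [duhamel_apply]
  set φ : ℝ → ℝ := fun s => heatFlow hT h s (t - s) x with hφ
  have hφc : Continuous φ := Continuous.heatFlow hT h continuous_id (by fun_prop) continuous_const
  have hΦ : ∀ s, HasDerivAt (fun s => ∫ r in (0 : ℝ)..s, φ r) (φ s) s := fun s =>
    intervalIntegral.integral_hasDerivAt_right (hφc.intervalIntegrable _ _)
      (hφc.stronglyMeasurableAtFilter _ _) hφc.continuousAt
  have hexp : ∀ s, HasDerivAt (fun s => Real.exp (-c * (t - s))) (Real.exp (-c * (t - s)) * c) s := by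
    intro s
    have := (((hasDerivAt_id s).const_sub t).const_mul (-c)).exp
    simpa using this
  have hΦc : Continuous (fun s => ∫ r in (0 : ℝ)..s, φ r) :=
    continuous_iff_continuousAt.2 fun s => (hΦ s).continuousAt
  -- With Φ(s) = ∫_0^s φ, integrate the derivative of e^{-c(t-s)} Φ(s) over [0, t]. By
  -- `heatFlow_duhamel`, Φ(s) is exactly P_{t-s} applied to (D h)(s).
  have hftc := intervalIntegral.integral_eq_sub_of_hasDerivAt (a := 0) (b := t)
    (fun s _ => (hexp s).mul (hΦ s)) (Continuous.intervalIntegrable (by fun_prop) _ _)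
  simp only [Pi.mul_apply, sub_self, mul_zero, Real.exp_zero, one_mul,
    intervalIntegral.integral_same, sub_zero] at hftc
  change ∫ s in (0 : ℝ)..t, φ s = _
  rw [← hftc]
  refine intervalIntegral.integral_congr fun s hs => ?_
  rw [Set.uIcc_of_le ht.1] at hs
  simp only [heatFlow_add_smul]
  rw [heatFlow_duhamel hT h ⟨hs.1, hs.2.trans ht.2⟩ (sub_nonneg.2 hs.2)]
  simp only [sub_add_sub_cancel, hφ]
  ring

/-- The maximum principle: a source term that pulls the solution back towards zero, up to a linear
growth `κ` and an error `ε`, keeps the solution of size `ε`. -/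
theorem abs_duhamel_le (h : SpaceTimeCb d T) {κ ε : ℝ} (hκ : 0 ≤ κ) (hε : 0 ≤ ε)
    (hpos : ∀ p, 0 < duhamel hT h p → h p ≤ κ * duhamel hT h p + ε)
    (hneg : ∀ p, duhamel hT h p < 0 → κ * duhamel hT h p - ε ≤ h p)
    (p : Set.Icc (0 : ℝ) T × EuclideanSpace ℝ (Fin d)) :
    |duhamel hT h p| ≤ ε * Real.exp ((κ + 1) * T) := by
  set w := duhamel hT h with hw
  set μ := κ + 1 with hμ
  have hμ0 : 0 < μ := by positivity
  have hbdd : BddAbove (Set.range fun q : Set.Icc (0 : ℝ) T × EuclideanSpace ℝ (Fin d) =>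
      Real.exp (-μ * q.1) * |w q|) := by
    refine ⟨‖w‖, ?_⟩
    rintro _ ⟨q, rfl⟩
    have h1 : Real.exp (-μ * q.1) ≤ 1 := Real.exp_le_one_iff.2 (by
      have := q.1.2.1
      nlinarith)
    calc Real.exp (-μ * q.1) * |w q| ≤ 1 * ‖w‖ := by
          gcongr
          exact w.norm_coe_le_norm q
      _ = ‖w‖ := one_mul _
  -- The weighted supremum of |w|; the goal is m ≤ ε. The rate μ = κ + 1 exceeds the growth rate κ
  -- by 1.
  set m := ⨆ q : Set.Icc (0 : ℝ) T × EuclideanSpace ℝ (Fin d), Real.exp (-μ * q.1) * |w q| with hm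
  have hwm : ∀ q, |w q| ≤ m * Real.exp (μ * q.1) := by
    intro q
    have := le_ciSup hbdd q
    rw [← hm] at this
    calc |w q| = Real.exp (-μ * q.1) * |w q| * Real.exp (μ * q.1) := by
          rw [mul_right_comm, ← Real.exp_add]
          simp
      _ ≤ _ := by gcongr
  have hmε : m ≤ ε := by
    rcases le_or_gt m 0 with hm0 | hm0
    · exact hm0.trans hε
    -- Chosen so that ‖h‖ = c m: on the side where h has no one-sided bound, the crude bound ‖h‖
    -- then costs no more than c |w| may.
    set c := ‖h‖ / m with hc
    have hc0 : 0 ≤ c := by positivity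
    have hcm : c * m = ‖h‖ := by
      rw [hc]
      field_simp
    set A := (κ + c) * m + ε with hA
    have hA0 : 0 ≤ A := by positivity
    -- Where w > 0, the upper bound uses h ≤ κ w + ε and the lower one uses h ≥ -‖h‖ and c w ≥ 0; w
    -- < 0 is symmetric, and at w = 0 the bound ‖h‖ suffices.
    have hpt : ∀ q, |(h + c • w) q| ≤ A * Real.exp (μ * q.1) := by
      intro q
      have he : 1 ≤ Real.exp (μ * q.1) := Real.one_le_exp (mul_nonneg hμ0.le q.1.2.1)
      have h1 := abs_le.1 (h.norm_coe_le_norm q)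
      have h2 := abs_le.1 (hwm q)
      have h3 := hpos q
      have h4 := hneg q
      rw [BoundedContinuousFunction.add_apply, BoundedContinuousFunction.smul_apply, smul_eq_mul]
      generalize w q = W at *
      generalize h q = H at *
      generalize Real.exp (μ * q.1) = e at *
      have e1 : ‖h‖ ≤ c * (m * e) := by
        rw [← mul_assoc, hcm]
        exact le_mul_of_one_le_right (norm_nonneg _) he
      have e2 : 0 ≤ κ * (m * e) := by positivity
      have e3 : ε ≤ ε * e := le_mul_of_one_le_right hε he
      have e4 : A * e = κ * (m * e) + c * (m * e) + ε * e := by rw [hA]; ring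
      rw [e4, abs_le]
      have k1 := mul_le_mul_of_nonneg_left h2.1 hc0
      have k2 := mul_le_mul_of_nonneg_left h2.2 hc0
      have k3 := mul_le_mul_of_nonneg_left h2.1 hκ
      have k4 := mul_le_mul_of_nonneg_left h2.2 hκ
      rcases lt_trichotomy W 0 with hW | hW | hW
      · have := h4 hW
        have := mul_nonpos_of_nonneg_of_nonpos hc0 hW.le
        constructor <;> linarith
      · subst hW
        constructor <;> linarith
      · have := h3 hW
        have := mul_nonneg hc0 hW.le
        constructor <;> linarith
    have hmle : m ≤ A / (c + μ) := by
      have : Nonempty (Set.Icc (0 : ℝ) T) := ⟨⟨0, le_rfl, hT.le⟩⟩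
      refine ciSup_le ?_
      rintro ⟨⟨t, ht⟩, x⟩
      have hint : |w (⟨t, ht⟩, x)| ≤ ∫ s in (0 : ℝ)..t,
          Real.exp (-c * (t - s)) * (A * Real.exp (μ * s)) := by
        rw [hw, duhamel_eq_damped hT h c, ← Real.norm_eq_abs]
        have hg : Continuous fun s => Real.exp (-c * (t - s)) * (A * Real.exp (μ * s)) := by
          fun_prop
        refine intervalIntegral.norm_integral_le_of_norm_le ht.1 (ae_of_all _ fun s hs => ?_)
          (hg.intervalIntegrable _ _)
        rw [norm_mul, Real.norm_eq_abs, Real.abs_exp]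
        gcongr
        refine abs_heatFlow_le hT _ (fun y => ?_) _ _
        have := hpt (Set.projIcc 0 T hT.le s, y)
        rwa [Set.projIcc_of_mem hT.le ⟨hs.1.le, hs.2.trans ht.2⟩] at this ⊢
      have hval : ∫ s in (0 : ℝ)..t, Real.exp (-c * (t - s)) * (A * Real.exp (μ * s)) =
          A * Real.exp (-c * t) * ((Real.exp ((c + μ) * t) - 1) / (c + μ)) := by
        have hne : c + μ ≠ 0 := by positivity
        have : ∀ s, Real.exp (-c * (t - s)) * (A * Real.exp (μ * s)) =
            A * Real.exp (-c * t) * Real.exp ((c + μ) * s) := by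
          intro s
          rw [mul_left_comm, ← Real.exp_add, mul_assoc, ← Real.exp_add]
          ring_nf
        simp_rw [this]
        rw [intervalIntegral.integral_const_mul, intervalIntegral.integral_comp_mul_left _ hne, integral_exp]
        simp [div_eq_inv_mul]
      rw [hval] at hint
      calc Real.exp (-μ * t) * |w (⟨t, ht⟩, x)|
          ≤ Real.exp (-μ * t) *
            (A * Real.exp (-c * t) * (Real.exp ((c + μ) * t) / (c + μ))) := by
            refine mul_le_mul_of_nonneg_left (hint.trans ?_) (Real.exp_pos _).le
            gcongr
            linarith
        _ = A / (c + μ) * (Real.exp (-μ * t) * Real.exp (-c * t) * Real.exp ((c + μ) * t)) := by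
            ring
        _ = A / (c + μ) := by
            rw [← Real.exp_add, ← Real.exp_add,
              show -μ * t + -c * t + (c + μ) * t = 0 by ring, Real.exp_zero, mul_one]
    -- Now m (c + κ + 1) ≤ (κ + c) m + ε; the terms in κ and c cancel, leaving m ≤ ε.
    rw [le_div_iff₀ (by positivity)] at hmle
    linarith
  refine (hwm p).trans ?_
  have := p.1.2.2
  gcongr

end HeatFlow

/-! ### Superposition operators -/

section Superposition

variable {X : Type*} [TopologicalSpace X]

theorem exists_bound_superposition (F : C(ℝ, ℝ)) (u : X →ᵇ ℝ) : ∃ C, ∀ p, ‖F (u p)‖ ≤ C := by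
  obtain ⟨C, hC⟩ := (isCompact_Icc (a := -‖u‖) (b := ‖u‖)).exists_bound_of_continuousOn
    F.continuous.continuousOn
  exact ⟨C, fun p => hC _ (abs_le.1 (u.norm_coe_le_norm p))⟩

/-- The superposition operator `u ↦ F ∘ u` on bounded continuous functions. -/
noncomputable def superposition (F : C(ℝ, ℝ)) (u : X →ᵇ ℝ) : X →ᵇ ℝ :=
  BoundedContinuousFunction.ofNormedAddCommGroup (fun p => F (u p))
    (F.continuous.comp u.continuous) _ (exists_bound_superposition F u).choose_spec

@[simp]
theorem superposition_apply (F : C(ℝ, ℝ)) (u : X →ᵇ ℝ) (p : X) :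
    superposition F u p = F (u p) := rfl

theorem continuous_superposition {F : C(ℝ, ℝ)} (hF : UniformContinuous F) :
    Continuous (superposition F : (X →ᵇ ℝ) → (X →ᵇ ℝ)) := by
  refine UniformContinuous.continuous (Metric.uniformContinuous_iff.2 fun ε hε => ?_)
  obtain ⟨δ, hδ, h⟩ := Metric.uniformContinuous_iff.1 hF (ε / 2) (half_pos hε)
  refine ⟨δ, hδ, fun {u v} huv => lt_of_le_of_lt ?_ (half_lt_self hε)⟩
  exact (BoundedContinuousFunction.dist_le (half_pos hε).le).2 fun p =>
    (h ((BoundedContinuousFunction.dist_coe_le_dist p).trans_lt huv)).le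

end Superposition

/-! ### Mild solutions: Lipschitz case, stability, limits -/

section MildSolution

variable {d : ℕ} {T : ℝ} (hT : 0 < T)

theorem continuous_duhamel : Continuous (duhamel hT : SpaceTimeCb d T → SpaceTimeCb d T) := by
  refine (LipschitzWith.of_dist_le_mul (K := ⟨T, hT.le⟩) fun h g => ?_).continuous
  rw [dist_eq_norm, dist_eq_norm, ← duhamel_sub, mul_comm]
  exact norm_duhamel_le hT _

/-- Integrating M e^{μs} gains a factor 1/μ, which makes Picard iteration contract on all of [0, T]
at once. -/
theorem abs_duhamel_le_of_exp (h : SpaceTimeCb d T) {M μ : ℝ} (hM : 0 ≤ M) (hμ : 0 < μ)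
    (hh : ∀ p, |h p| ≤ M * Real.exp (μ * p.1))
    (p : Set.Icc (0 : ℝ) T × EuclideanSpace ℝ (Fin d)) :
    |duhamel hT h p| ≤ M / μ * Real.exp (μ * p.1) := by
  obtain ⟨⟨t, ht⟩, x⟩ := p
  have hg : Continuous fun s => M * Real.exp (μ * s) := by fun_prop
  have hint : |duhamel hT h (⟨t, ht⟩, x)| ≤ ∫ s in (0 : ℝ)..t, M * Real.exp (μ * s) := by
    rw [duhamel_apply, ← Real.norm_eq_abs]
    refine intervalIntegral.norm_integral_le_of_norm_le ht.1 (ae_of_all _ fun s hs => ?_)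
      (hg.intervalIntegrable _ _)
    refine abs_heatFlow_le hT _ (fun y => ?_) _ _
    have := hh (Set.projIcc 0 T hT.le s, y)
    rwa [Set.projIcc_of_mem hT.le ⟨hs.1.le, hs.2.trans ht.2⟩] at this ⊢
  rw [intervalIntegral.integral_const_mul, intervalIntegral.integral_comp_mul_left _ hμ.ne',
    integral_exp, mul_zero, Real.exp_zero, smul_eq_mul] at hint
  refine hint.trans ?_
  rw [div_eq_mul_inv, mul_assoc]
  gcongr
  linarith

/-- The bounded continuous weight `(t, x) ↦ exp (c t)`. -/
noncomputable def expWeight (d : ℕ) (T c : ℝ) : SpaceTimeCb d T :=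
  BoundedContinuousFunction.ofNormedAddCommGroup (fun p => Real.exp (c * p.1)) (by fun_prop)
    (Real.exp (|c| * T)) (by
      rintro ⟨⟨t, h0, h1⟩, x⟩
      rw [Real.norm_eq_abs, Real.abs_exp]
      gcongr
      exact le_abs_self c)

@[simp]
theorem expWeight_apply (c : ℝ) (p : Set.Icc (0 : ℝ) T × EuclideanSpace ℝ (Fin d)) :
    expWeight d T c p = Real.exp (c * p.1) := rfl

/-- Mild solutions for Lipschitz nonlinearities, by Picard iteration in a weighted norm. -/
theorem exists_mild_of_lipschitz (F : C(ℝ, ℝ)) {L : NNReal} (hF : LipschitzWith L F)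
    (z : SpaceTimeCb d T) : ∃ u, u = duhamel hT (superposition F u) + z := by
  -- Makes the contraction factor L / μ at most 1/2.
  set μ : ℝ := 2 * L + 1 with hμ
  have hμ0 : 0 < μ := by positivity
  set Φ : SpaceTimeCb d T → SpaceTimeCb d T := fun v =>
    expWeight d T (-μ) * (duhamel hT (superposition F (expWeight d T μ * v)) + z) with hΦ
  have hcontr : ContractingWith (1 / 2) Φ := by
    refine ⟨by norm_num, LipschitzWith.of_dist_le_mul fun v v' => ?_⟩
    refine (BoundedContinuousFunction.dist_le (by positivity)).2 fun p => ?_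
    have hp : Φ v p - Φ v' p = Real.exp (-μ * p.1) *
        duhamel hT (superposition F (expWeight d T μ * v) -
          superposition F (expWeight d T μ * v')) p := by
      rw [duhamel_sub]
      simp only [hΦ, BoundedContinuousFunction.mul_apply, BoundedContinuousFunction.add_apply,
        BoundedContinuousFunction.sub_apply, expWeight_apply]
      ring
    have hD := abs_duhamel_le_of_exp hT (superposition F (expWeight d T μ * v) -
          superposition F (expWeight d T μ * v')) (M := L * dist v v') (by positivity) hμ0
      (fun q => by
        have h1 := hF.dist_le_mul ((expWeight d T μ * v) q) ((expWeight d T μ * v') q)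
        have h2 := BoundedContinuousFunction.dist_coe_le_dist (f := v) (g := v') q
        rw [Real.dist_eq] at h1 h2
        refine h1.trans ?_
        rw [Real.dist_eq, BoundedContinuousFunction.mul_apply, BoundedContinuousFunction.mul_apply,
          ← mul_sub, abs_mul, expWeight_apply, Real.abs_exp, mul_assoc, mul_comm (Real.exp _)]
        gcongr) p
    rw [Real.dist_eq, hp, abs_mul, Real.abs_exp]
    calc Real.exp (-μ * p.1) * _ ≤ Real.exp (-μ * p.1) * _ :=
          mul_le_mul_of_nonneg_left hD (Real.exp_pos _).le
      _ = L * dist v v' / μ * (Real.exp (-μ * p.1) * Real.exp (μ * p.1)) := by ring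
      _ = L * dist v v' / μ := by
          rw [← Real.exp_add, neg_mul, neg_add_cancel, Real.exp_zero, mul_one]
      _ ≤ _ := by
          rw [div_le_iff₀ hμ0, hμ]
          push_cast
          nlinarith [dist_nonneg (x := v) (y := v')]
  have hfix : Φ hcontr.fixedPoint = hcontr.fixedPoint := hcontr.fixedPoint_isFixedPt
  refine ⟨expWeight d T μ * hcontr.fixedPoint, ?_⟩
  conv_lhs => rw [← hfix]
  simp only [hΦ]
  rw [← mul_assoc]
  have hone : expWeight d T μ * expWeight d T (-μ) = 1 := by
    ext p
    simp [← Real.exp_add]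
  rw [hone, one_mul]

/-- Stability of mild solutions in the nonlinearity, under a one-sided Lipschitz condition. -/
theorem dist_mild_le {F₁ F₂ : C(ℝ, ℝ)} {κ ε : ℝ} (hκ : 0 ≤ κ) (hε : 0 ≤ ε)
    (h₁ : ∀ a b, b < a → F₁ a - F₁ b ≤ κ * (a - b)) (h₁₂ : ∀ a, |F₁ a - F₂ a| ≤ ε)
    {z u₁ u₂ : SpaceTimeCb d T} (hu₁ : u₁ = duhamel hT (superposition F₁ u₁) + z)
    (hu₂ : u₂ = duhamel hT (superposition F₂ u₂) + z) :
    dist u₁ u₂ ≤ ε * Real.exp ((κ + 1) * T) := by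
  have hw : ∀ p, duhamel hT (superposition F₁ u₁ - superposition F₂ u₂) p = u₁ p - u₂ p := by
    intro p
    rw [duhamel_sub]
    conv_rhs => rw [hu₁, hu₂]
    simp
  refine (BoundedContinuousFunction.dist_le (by positivity)).2 fun p => ?_
  rw [Real.dist_eq, ← hw]
  refine abs_duhamel_le hT _ hκ hε (fun q hq => ?_) (fun q hq => ?_) p
  all_goals
    rw [hw] at hq ⊢
    have h3 := abs_le.1 (h₁₂ (u₂ q))
    simp only [BoundedContinuousFunction.sub_apply, superposition_apply]
  · have := h₁ (u₁ q) (u₂ q) (by linarith)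
    linarith
  · have := h₁ (u₂ q) (u₁ q) (by linarith)
    linarith

/-- A priori bound for mild solutions, under a one-sided Lipschitz condition. -/
theorem abs_mild_sub_le {F : C(ℝ, ℝ)} {κ C : ℝ} (hκ : 0 ≤ κ) (hC : 0 ≤ C)
    (hF : ∀ a b, b < a → F a - F b ≤ κ * (a - b)) {z u : SpaceTimeCb d T}
    (hz : ∀ p, |F (z p)| ≤ C) (hu : u = duhamel hT (superposition F u) + z)
    (p : Set.Icc (0 : ℝ) T × EuclideanSpace ℝ (Fin d)) :
    |u p - z p| ≤ C * Real.exp ((κ + 1) * T) := by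
  have hw : ∀ p, duhamel hT (superposition F u) p = u p - z p := by
    intro p
    conv_rhs => rw [hu]
    simp
  rw [← hw]
  refine abs_duhamel_le hT _ hκ hC (fun q hq => ?_) (fun q hq => ?_) p
  all_goals
    rw [hw] at hq ⊢
    have h3 := abs_le.1 (hz q)
    simp only [superposition_apply]
  · have := hF (u q) (z q) (by linarith)
    linarith
  · have := hF (z q) (u q) (by linarith)
    linarith

/-- Existence of mild solutions passes to uniform limits of one-sided Lipschitz nonlinearities. -/
theorem exists_mild_of_approx {F : C(ℝ, ℝ)} {κ : ℝ} (hκ : 0 ≤ κ) (hF : UniformContinuous F)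
    (happ : ∀ ε : ℝ, 0 < ε → ∃ (F' : C(ℝ, ℝ)) (L : NNReal), LipschitzWith L F' ∧
      (∀ a b, b < a → F' a - F' b ≤ κ * (a - b)) ∧ ∀ a, |F' a - F a| ≤ ε)
    (z : SpaceTimeCb d T) : ∃ u, u = duhamel hT (superposition F u) + z := by
  choose G L hL hG hGF using fun n : ℕ => happ (1 / ((n : ℝ) + 1)) (by positivity)
  choose u hu using fun n => exists_mild_of_lipschitz hT (G n) (hL n) z
  have hlim : Filter.Tendsto (fun n : ℕ => 1 / ((n : ℝ) + 1)) Filter.atTop (nhds 0) :=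
    tendsto_one_div_add_atTop_nhds_zero_nat
  have hcauchy : CauchySeq u := by
    -- For n, m ≥ N both nonlinearities lie within 1/(N+1) of F, hence within 2/(N+1) of each other.
    refine cauchySeq_of_le_tendsto_0
      (fun n : ℕ => 2 * (1 / ((n : ℝ) + 1)) * Real.exp ((κ + 1) * T)) (fun n m N hn hm => ?_) ?_
    · refine dist_mild_le hT hκ (by positivity) (hG n) (fun a => ?_) (hu n) (hu m)
      have h1 := abs_le.1 (hGF n a)
      have h2 := abs_le.1 (hGF m a)
      have h3 : 1 / ((n : ℝ) + 1) ≤ 1 / ((N : ℝ) + 1) := by gcongr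
      have h4 : 1 / ((m : ℝ) + 1) ≤ 1 / ((N : ℝ) + 1) := by gcongr
      rw [abs_le]
      constructor <;> linarith
    · simpa using (hlim.const_mul 2).mul_const (Real.exp ((κ + 1) * T))
  obtain ⟨v, hv⟩ := cauchySeq_tendsto_of_complete hcauchy
  have hFv : Filter.Tendsto (fun n => superposition F (u n)) Filter.atTop
      (nhds (superposition F v)) := ((continuous_superposition hF).tendsto v).comp hv
  have hGv : Filter.Tendsto (fun n => superposition (G n) (u n)) Filter.atTop
      (nhds (superposition F v)) := by
    refine hFv.congr_dist (squeeze_zero (fun _ => dist_nonneg) (fun n => ?_) hlim)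
    refine (BoundedContinuousFunction.dist_le (by positivity)).2 fun p => ?_
    rw [dist_comm]
    exact hGF n _
  refine ⟨v, tendsto_nhds_unique hv ?_⟩
  have := (((continuous_duhamel hT).tendsto _).comp hGv).add_const z
  exact this.congr fun n => (hu n).symm

end MildSolution

/-! ### Approximation, truncation and the general nonlinearity -/

/-- A bounded, uniformly continuous, monotone function is a uniform limit of monotone Lipschitz
functions, its moving averages. -/
theorem exists_monotone_lipschitz_approx {g : ℝ → ℝ} (hg : UniformContinuous g) (hmono : Monotone g)
    {M : ℝ} (hM : ∀ x, |g x| ≤ M) {ε : ℝ} (hε : 0 < ε) :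
    ∃ (g' : ℝ → ℝ) (L : NNReal), LipschitzWith L g' ∧ Monotone g' ∧ ∀ x, |g' x - g x| ≤ ε := by
  obtain ⟨δ, hδ, h⟩ := Metric.uniformContinuous_iff.1 hg ε hε
  set r := δ / 2 with hr
  have hr0 : 0 < r := half_pos hδ
  have hM0 : 0 ≤ M := (abs_nonneg _).trans (hM 0)
  have hi : ∀ a b, IntervalIntegrable g volume a b := fun a b =>
    hg.continuous.intervalIntegrable a b
  have hi' : ∀ x, IntervalIntegrable (fun s => g (x + s)) volume 0 r := fun x =>
    (hg.continuous.comp (by fun_prop)).intervalIntegrable _ _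
  refine ⟨fun x => r⁻¹ * ∫ s in (0 : ℝ)..r, g (x + s), ⟨r⁻¹ * (2 * M), by positivity⟩, ?_, ?_, ?_⟩
  · refine LipschitzWith.of_dist_le_mul fun x y => ?_
    have hb : ∀ a b, |∫ s in a..b, g s| ≤ M * |b - a| := fun a b => by
      rw [← Real.norm_eq_abs (∫ s in a..b, g s)]
      exact intervalIntegral.norm_integral_le_of_norm_le_const fun s _ => hM s
    -- The windows [x, x+r] and [y, y+r] differ by two end pieces of length |x - y|, whence the
    -- Lipschitz constant 2M/r.
    have e : (∫ s in (0 : ℝ)..r, g (x + s)) - ∫ s in (0 : ℝ)..r, g (y + s) =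
        (∫ s in (y + r)..(x + r), g s) - ∫ s in y..x, g s := by
      rw [intervalIntegral.integral_comp_add_left, intervalIntegral.integral_comp_add_left,
        add_zero, add_zero]
      have h1 := intervalIntegral.integral_add_adjacent_intervals (hi y x) (hi x (x + r))
      have h2 := intervalIntegral.integral_add_adjacent_intervals (hi y (y + r)) (hi (y + r) (x + r))
      linarith
    have h1 := hb (y + r) (x + r)
    have h2 := hb y x
    rw [add_sub_add_right_eq_sub] at h1
    rw [Real.dist_eq, ← mul_sub, e, abs_mul, abs_of_pos (inv_pos.2 hr0), Real.dist_eq]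
    change _ ≤ r⁻¹ * (2 * M) * _
    rw [mul_assoc]
    gcongr
    refine (abs_sub _ _).trans ?_
    linarith
  · intro x y hxy
    dsimp only
    gcongr
    exact intervalIntegral.integral_mono hr0.le (hi' x) (hi' y) fun s => hmono (by linarith)
  · intro x
    have e : r⁻¹ * (∫ s in (0 : ℝ)..r, g (x + s)) - g x =
        r⁻¹ * ∫ s in (0 : ℝ)..r, (g (x + s) - g x) := by
      rw [intervalIntegral.integral_sub (hi' x) intervalIntegrable_const,
        intervalIntegral.integral_const, sub_zero, smul_eq_mul]
      field_simp
    have hb : |∫ s in (0 : ℝ)..r, (g (x + s) - g x)| ≤ ε * |r - 0| := by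
      rw [← Real.norm_eq_abs (∫ s in (0 : ℝ)..r, (g (x + s) - g x))]
      refine intervalIntegral.norm_integral_le_of_norm_le_const fun s hs => ?_
      rw [Set.uIoc_of_le hr0.le] at hs
      refine (h ?_).le
      rw [Real.dist_eq, add_sub_cancel_left, abs_of_pos hs.1]
      linarith [hs.2]
    rw [sub_zero, abs_of_pos hr0] at hb
    rw [e, abs_mul, abs_of_pos (inv_pos.2 hr0), inv_mul_le_iff₀ hr0, mul_comm]
    exact hb

theorem exists_mild {d : ℕ} {T : ℝ} (hT : 0 < T) (f : C(ℝ, ℝ)) {κ : ℝ} (hκ : 0 ≤ κ)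
    (hf : ∀ a b, b < a → f a - f b ≤ κ * (a - b)) (z : SpaceTimeCb d T) :
    ∃ u, u = duhamel hT (superposition f u) + z := by
  set C := ‖superposition f z‖ with hC
  -- The a priori bound for |u|: the truncation at R is therefore never felt by the solution.
  set R := ‖z‖ + C * Real.exp ((κ + 1) * T) with hR
  have hCe : 0 ≤ C * Real.exp ((κ + 1) * T) := by positivity
  have hR0 : 0 ≤ R := by positivity
  have hRR : -R ≤ R := by linarith
  set g : ℝ → ℝ := fun x => κ * x - f x with hg
  have hgc : Continuous g := by fun_prop
  have hgm : Monotone g := fun a b hab => by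
    rcases hab.eq_or_lt with rfl | hlt
    · exact le_rfl
    · have := hf b a hlt
      simp only [hg]
      linarith
  set c : ℝ → ℝ := fun x => Set.projIcc (-R) R hRR x with hc
  have hgu : UniformContinuous (g ∘ c) :=
    (CompactSpace.uniformContinuous_of_continuous (hgc.comp continuous_subtype_val)).comp
      (LipschitzWith.projIcc hRR).uniformContinuous
  have hcm : Monotone c := fun a b hab => Set.monotone_projIcc hRR hab
  have hcR : ∀ x, |x| ≤ R → c x = x := fun x hx => by
    simp only [hc]
    rw [Set.projIcc_of_mem hRR (abs_le.1 hx)]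
  obtain ⟨M, hM⟩ := (isCompact_Icc (a := -R) (b := R)).exists_bound_of_continuousOn hgc.continuousOn
  -- The modified nonlinearity equals f on [-R, R], and stays one-sided Lipschitz with constant κ
  -- because g ∘ c is monotone.
  have hFu : UniformContinuous fun x => κ * x - g (c x) :=
    ((LipschitzWith.id.uniformContinuous).const_mul' κ).sub hgu
  set F : C(ℝ, ℝ) := ⟨fun x => κ * x - g (c x), hFu.continuous⟩ with hF
  have hFf : ∀ x, |x| ≤ R → F x = f x := fun x hx => by
    change κ * x - g (c x) = f x
    rw [hcR x hx]
    simp [hg]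
  obtain ⟨u, hu⟩ := exists_mild_of_approx hT hκ hFu (F := F) (fun ε hε => by
    obtain ⟨g', L, hL, hm, hε'⟩ := exists_monotone_lipschitz_approx hgu (hgm.comp hcm)
      (fun x => hM _ (Set.projIcc (-R) R hRR x).2) hε
    have hl : LipschitzWith (⟨κ, hκ⟩ + L) fun x => κ * x - g' x :=
      (LipschitzWith.of_dist_le_mul fun x y => by
        rw [Real.dist_eq, Real.dist_eq, ← mul_sub, abs_mul, abs_of_nonneg hκ]; rfl).sub hL
    refine ⟨⟨fun x => κ * x - g' x, hl.continuous⟩, _, hl, fun a b hab => ?_, fun a => ?_⟩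
    · have := hm hab.le
      simp only [ContinuousMap.coe_mk]
      linarith
    · simp only [ContinuousMap.coe_mk, hF, sub_sub_sub_cancel_left]
      rw [abs_sub_comm]
      exact hε' a) z
  refine ⟨u, ?_⟩
  have hzR : ∀ p, |z p| ≤ R := fun p => (z.norm_coe_le_norm p).trans (by linarith)
  have huR : ∀ p, |u p| ≤ R := fun p => by
    have h1 := abs_mild_sub_le hT hκ (norm_nonneg _ : 0 ≤ C) (fun a b hab => by
        have := (hgm.comp hcm) hab.le
        simp only [Function.comp_apply] at this
        simp only [hF, ContinuousMap.coe_mk]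
        linarith) (fun q => by
        rw [hFf _ (hzR q)]
        exact (superposition f z).norm_coe_le_norm q) hu p
    have h2 := z.norm_coe_le_norm p
    rw [Real.norm_eq_abs] at h2
    have h3 := abs_sub_abs_le_abs_sub (u p) (z p)
    linarith
  have : superposition F u = superposition f u := by
    ext p
    exact hFf _ (huR p)
  rwa [this] at hu

/-! ### Return to the kernel form of the equation -/

theorem integral_duhamelIntegrand {d : ℕ} {T : ℝ} (hT : 0 < T) (f : C(ℝ, ℝ))
    (u : SpaceTimeCb d T) {s t : ℝ} (hst : s < t) (x : EuclideanSpace ℝ (Fin d)) :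
    ∫ y, duhamelIntegrand hT f u t x s y = heatFlow hT (superposition f u) s (t - s) x :=
  integral_heatKernel_mul (sub_pos.2 hst) x fun y => f (u (Set.projIcc 0 T hT.le s, y))

theorem integrable_heatKernel_sub {d : ℕ} {r : ℝ} (hr : 0 < r) (x : EuclideanSpace ℝ (Fin d)) :
    Integrable fun y => heatKernel d r (x - y) := by
  refine Integrable.of_integral_ne_zero ?_
  have := integral_heatKernel_mul hr x fun _ => 1
  simp only [mul_one] at this
  rw [this]
  simp

theorem measurable_heatKernel_sub {d : ℕ} (t : ℝ) (x : EuclideanSpace ℝ (Fin d)) :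
    Measurable fun p : ℝ × EuclideanSpace ℝ (Fin d) => heatKernel d (t - p.1) (x - p.2) := by
  unfold heatKernel
  fun_prop

/-- The kernel has mass 1 in y for each s < t, so Tonelli makes it integrable on (0, t) × ℝ^d; the
factor f ∘ u is bounded. -/
theorem integrableOn_duhamelIntegrand {d : ℕ} {T : ℝ} (hT : 0 < T) (f : C(ℝ, ℝ))
    (u : SpaceTimeCb d T) (t : ℝ) (x : EuclideanSpace ℝ (Fin d)) :
    IntegrableOn (fun p : ℝ × EuclideanSpace ℝ (Fin d) => duhamelIntegrand hT f u t x p.1 p.2)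
      (Set.Ioo (0 : ℝ) t ×ˢ Set.univ) := by
  have hpos : ∀ᵐ s ∂volume.restrict (Set.Ioo (0 : ℝ) t), 0 < t - s :=
    (ae_restrict_iff' measurableSet_Ioo).2 (ae_of_all _ fun s hs => sub_pos.2 hs.2)
  have hG : Integrable (fun p : ℝ × EuclideanSpace ℝ (Fin d) => heatKernel d (t - p.1) (x - p.2))
      ((volume.restrict (Set.Ioo (0 : ℝ) t)).prod volume) := by
    refine (integrable_prod_iff (measurable_heatKernel_sub t x).aestronglyMeasurable).2 ⟨?_, ?_⟩
    · filter_upwards [hpos] with s hs using integrable_heatKernel_sub hs x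
    · refine (integrable_const (1 : ℝ)).congr ?_
      filter_upwards [hpos] with s hs
      have := integral_heatKernel_mul hs x fun _ => 1
      simp only [mul_one] at this
      simp_rw [Real.norm_eq_abs, abs_of_nonneg (heatKernel_nonneg hs.le _)]
      rw [this]
      simp
  rw [IntegrableOn, Measure.volume_eq_prod, ← Measure.prod_restrict, Measure.restrict_univ]
  have hcont : Continuous fun p : ℝ × EuclideanSpace ℝ (Fin d) =>
      superposition f u (Set.projIcc 0 T hT.le p.1, p.2) := by
    have := continuous_projIcc (h := hT.le)
    fun_prop
  exact hG.mul_bdd (c := ‖superposition f u‖) hcont.aestronglyMeasurable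
    (ae_of_all _ fun p => (superposition f u).norm_coe_le_norm _)

theorem solvesIntegralEquation_of_mild {d : ℕ} {T : ℝ} (hT : 0 < T) (f : C(ℝ, ℝ))
    {z u : SpaceTimeCb d T} (hu : u = duhamel hT (superposition f u) + z) :
    SolvesIntegralEquation hT f z u := by
  intro t x
  refine ⟨integrableOn_duhamelIntegrand hT f u t x, ?_⟩
  have h1 : u (t, x) = duhamel hT (superposition f u) (t, x) + z (t, x) := by
    conv_lhs => rw [hu]
    rfl
  -- The endpoint s = t is discarded, since the kernel represents the heat flow only at positive
  -- times.
  rw [h1, duhamel_apply, intervalIntegral.integral_of_le t.2.1, intervalIntegral.integral_of_le t.2.1,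
    integral_Ioc_eq_integral_Ioo, integral_Ioc_eq_integral_Ioo]
  congr 1
  refine setIntegral_congr_fun measurableSet_Ioo fun s hs => ?_
  exact (integral_duhamelIntegrand hT f u hs.2 x).symm

theorem mainTheorem6 (d : ℕ) (f : ℝ → ℝ) (hf : Continuous f)
    (κ : ℝ) (hκ : ∀ u₁ u₂ : ℝ, u₁ < u₂ → f u₂ - f u₁ ≤ κ * (u₂ - u₁))
    (K ν : ℝ) (hK : 0 < K) (hν : 0 ≤ ν)
    (hgrowth : ∀ u : ℝ, |f u| ≤ K * Real.exp (K * |u| ^ ν))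
    (T : ℝ) (hT : 0 < T) (z : SpaceTimeCb d T) :
    ∃ u : SpaceTimeCb d T, SolvesIntegralEquation hT f z u := by
  -- Replacing κ by max κ 0 weakens the one-sided condition and supplies the sign needed for the
  -- maximum principle.
  obtain ⟨u, hu⟩ := exists_mild hT ⟨f, hf⟩ (le_max_right κ 0) (fun a b hab =>
    (hκ b a hab).trans (mul_le_mul_of_nonneg_right (le_max_left κ 0) (sub_pos.2 hab).le)) z
  exact ⟨u, solvesIntegralEquation_of_mild hT ⟨f, hf⟩ hu⟩
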